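/- Let $\mathbb{F}$ be a field, let $N$ be an even natural number, and let $\mathbb{G}=\mathbb{F}(\mathcal{W})$ be the field of rational functions over $\mathbb{F}$ in the variables $\mathcal{W}=\{w_{i,k,j} : i,k,j\in\{1,\dots,N\}\}$. For integers $i\ge 1$, $j\ge i-1$ such that the interval $[i,j]\subseteq\{1,\dots,N\}$ has even length $j-i+1$, define $g_{i,j}\in\mathbb{G}[x_1,\dots,x_N]$ by $g_{i,j}=1$ if $[i,j]$ is empty, and otherwise \[ g_{i,j}=(1+x_ix_j)\,g_{i+1,j-1}+\sum_{k} w_{i,k,j}\,g_{i,k}\,g_{k+1,j}, \] where $k$ ranges over the integers $i+1\le k\le j-2$ for which $[i,k]$ has even length. Let $g=g_{1,N}$ (the Raz--Yehudayoff full-rank polynomial). An algebraic branching program (ABP) over $\mathbb{G}$ is a layered directed acyclic graph, with edges only between consecutive layers, each labelled by a variable $x_i$ or by an element of $\mathbb{G}$, with a start node in the first layer and a terminal node in the last layer; it computes the sum, over all paths from the start node to the terminal node, of the product of the edge labels along the path, and its size is its number of nodes. It is a read-once oblivious ABP (ROABP) if for every layer at most one variable labels the edges leaving that layer, and every variable appears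 as an edge label in at most one layer; the order in which the variables are read is arbitrary. There are absolute constants $\varepsilon>0$, $c>0$ and $N_0$ (independent of $\mathbb{F}$) such that, for every field $\mathbb{F}$ and every even $N\ge N_0$: if $g=f_1+\dots+f_m$, where every $f_i\in\mathbb{G}[x_1,\dots,x_N]$ is computed by an ROABP over $\mathbb{G}$ of size at most $s$ (different $f_i$ may use different variable orders), then \[ m\;\ge\;\frac{2^{\varepsilon N^{1/5}}}{s^{\,c\log_2 N}}. \] -/

import Mathlib

namespace ROABP

/-- An algebraic branching program over the field `K` in the variables `σ`: a layered directed
graph with layers `L_0, …, L_depth` (layer `i` consists of `width i` nodes), a start node in the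
first layer and a terminal node in the last one. Between a node `u` of layer `i` and a node `v` of
layer `i + 1` there is either no edge (`none`), or an edge labelled by a variable
(`some (Sum.inl x)`), or an edge labelled by a field constant (`some (Sum.inr a)`). -/
structure ABP (K : Type*) (σ : Type*) where
  depth : ℕ
  width : Fin (depth + 1) → ℕ
  edge : (i : Fin depth) → Fin (width i.castSucc) → Fin (width i.succ) → Option (σ ⊕ K)
  start : Fin (width 0)
  terminal : Fin (width (Fin.last depth))

namespace ABP

variable {K σ : Type*}

/-- The size of an ABP: its total number of nodes. -/
def size (P : ABP K σ) : ℕ := ∑ i, P.width i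

/-- The polynomial that labels an edge. A missing edge has weight `0`, so that a sequence of nodes
that is not a path contributes nothing to the sum over all paths. -/
noncomputable def labelPoly [CommSemiring K] : Option (σ ⊕ K) → MvPolynomial σ K
  | none => 0
  | some (Sum.inl x) => MvPolynomial.X x
  | some (Sum.inr a) => MvPolynomial.C a

/-- The polynomial computed by an ABP: the sum, over all paths from the start node to the terminal
node, of the product of the edge labels along the path. A path is given by its sequence of
nodes, one in every layer. -/
noncomputable def poly [CommSemiring K] (P : ABP K σ) : MvPolynomial σ K :=
  ∑ γ : ((i : Fin (P.depth + 1)) → Fin (P.width i)) with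
      γ 0 = P.start ∧ γ (Fin.last P.depth) = P.terminal,
    ∏ i : Fin P.depth, labelPoly (P.edge i (γ i.castSucc) (γ i.succ))

/-- The variable `x` labels an edge that leaves layer `i`. -/
def ReadsAt (P : ABP K σ) (i : Fin P.depth) (x : σ) : Prop :=
  ∃ u v, P.edge i u v = some (Sum.inl x)

/-- An ABP is oblivious if for every layer at most one variable labels edges from this layer. -/
def IsOblivious (P : ABP K σ) : Prop :=
  ∀ i x y, P.ReadsAt i x → P.ReadsAt i y → x = y

/-- A read-once oblivious ABP: an oblivious ABP in which each variable appears as an edge label in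
at most one layer. -/
def IsROABP (P : ABP K σ) : Prop :=
  P.IsOblivious ∧ ∀ x i j, P.ReadsAt i x → P.ReadsAt j x → i = j

end ABP

/-- The index set `[N] = {1, …, N}`. -/
abbrev Idx (N : ℕ) : Type := ↥(Finset.Icc 1 N)

/-- The field `𝔾 = F(W)` of rational functions over `F` in the variables
`W = {w_{i,k,j} : i, k, j ∈ [N]}`. -/
abbrev RatField (F : Type*) [Field F] (N : ℕ) : Type _ :=
  FractionRing (MvPolynomial (Idx N × Idx N × Idx N) F)

/-- The recursion that defines the full-rank polynomials `g_{i,j}` (for intervals `[i, j]` of even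
length), in an arbitrary commutative ring: `g_{i,j} = 1` for the empty interval, and otherwise
`g_{i,j} = (1 + x_i x_j) g_{i+1,j-1} + ∑_k w_{i,k,j} g_{i,k} g_{k+1,j}`, where the sum is over the
`k ∈ [i+1, j-2]` such that `[i, k]` has even length. -/
def gRec {R : Type*} [CommSemiring R] (x : ℕ → R) (w : ℕ → ℕ → ℕ → R) (i j : ℕ) : R :=
  if i ≤ j then
    (1 + x i * x j) * gRec x w (i + 1) (j - 1) +
      ∑ k : {k // k ∈ (Finset.Icc (i + 1) (j - 2)).filter (fun k => Even (k + 1 - i))},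
        w i k j * gRec x w i k * gRec x w (k + 1) j
  else 1
termination_by j + 1 - i
decreasing_by
  · omega
  · have := k.2
    simp only [Finset.mem_filter, Finset.mem_Icc] at this
    omega
  · have := k.2
    simp only [Finset.mem_filter, Finset.mem_Icc] at this
    omega

theorem gRec_of_lt {R : Type*} [CommSemiring R] (x : ℕ → R) (w : ℕ → ℕ → ℕ → R) {i j : ℕ}
    (h : j < i) : gRec x w i j = 1 := by
  rw [gRec, if_neg (by omega)]

theorem gRec_of_le {R : Type*} [CommSemiring R] (x : ℕ → R) (w : ℕ → ℕ → ℕ → R) {i j : ℕ}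
    (h : i ≤ j) : gRec x w i j = (1 + x i * x j) * gRec x w (i + 1) (j - 1) +
      ∑ k ∈ (Finset.Icc (i + 1) (j - 2)).filter (fun k => Even (k + 1 - i)),
        w i k j * gRec x w i k * gRec x w (k + 1) j := by
  rw [gRec, if_pos h]
  congr 1
  exact Finset.sum_coe_sort ((Finset.Icc (i + 1) (j - 2)).filter (fun k => Even (k + 1 - i)))
    (fun k => w i k j * gRec x w i k * gRec x w (k + 1) j)

/-- The variable `x_p` of `𝔾[X]`, `X = {x_1, …, x_N}` (only used for `p ∈ [N]`). -/
noncomputable def xVar (F : Type*) [Field F] (N : ℕ) (p : ℕ) :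
    MvPolynomial (Idx N) (RatField F N) :=
  if hp : p ∈ Finset.Icc 1 N then MvPolynomial.X ⟨p, hp⟩ else 0

/-- The element `w_{i,k,j}` of `𝔾`, as a constant of `𝔾[X]` (only used for `i, k, j ∈ [N]`). -/
noncomputable def wVar (F : Type*) [Field F] (N : ℕ) (i k j : ℕ) :
    MvPolynomial (Idx N) (RatField F N) :=
  if h : i ∈ Finset.Icc 1 N ∧ k ∈ Finset.Icc 1 N ∧ j ∈ Finset.Icc 1 N then
    MvPolynomial.C (algebraMap (MvPolynomial (Idx N × Idx N × Idx N) F) (RatField F N)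
      (MvPolynomial.X (⟨i, h.1⟩, ⟨k, h.2.1⟩, ⟨j, h.2.2⟩)))
  else 0

/-- The Raz–Yehudayoff full-rank polynomial `g = g_{1,N} ∈ 𝔾[x_1, …, x_N]`, for even `N`. -/
noncomputable def hardPoly (F : Type*) [Field F] (N : ℕ) :
    MvPolynomial (Idx N) (RatField F N) :=
  gRec (xVar F N) (wVar F N) 1 N

end ROABP

namespace ROABP

open MvPolynomial Finset

/-! The proof compares ranks of partial derivative matrices. For a partition of the variables into
`Y` and its complement, arrange the square-free coefficients of a polynomial in a matrix with rows
the subsets of `Y` and columns the subsets of `Yᶜ`.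

Lower bound: for every balanced `Y` the matrix of `g` is nonsingular (`fullRank_hardPoly`). It
suffices to find one good specialization of the `w`. If the endpoints of an interval lie on
different sides, the term `1 + x_i x_j` pairs them; if they lie on the same side, the interval
splits into two balanced ones, and a generic `w_{i,k,j}` selects this product
(`exists_fullRank_gRec`).

Upper bound: cutting an ROABP of size `s` at a point of its variable order writes it as at most `s`
products of polynomials in disjoint variables. If the prefix contains elements of `Y` and `Yᶜ` in
numbers differing by at least `D`, each product has rank at most `2 ^ (N/2 - D)`. Hence `2 ^ D ≤ m *
s` as soon as one balanced `Y` is unbalanced by `D` on some prefix of each of the `m` orders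
(`two_pow_le_of_fullRank_of_not_nearlyBalanced`).

Counting: for a fixed order, each successive block of `4 * D ^ 2` variables at least halves the
fraction of sets that remain nearly balanced. At most `2 ^ (N - t)` sets survive `t` blocks, while
there are at least `2 ^ N / N` balanced sets; so either such a `Y` exists or `2 ^ t ≤ m * N`. With
`D` and `t` of order `N ^ (1/5)` both cases give the bound, even with `s` in place of `s ^ (c * log
N)`. -/

/-- The coefficient of the square-free monomial `∏ i ∈ S, x_i` in `f`. -/
noncomputable def sqCoeff {σ R : Type*} [CommSemiring R] (f : MvPolynomial σ R) (S : Finset σ) :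
    R :=
  coeff (Finsupp.indicator S fun _ _ => 1) f

/-- The partial derivative matrix of `f` with rows indexed by the subsets of `P` and columns indexed
by the subsets of `Q` has full column rank. -/
def FullRank {σ R : Type*} [DecidableEq σ] [CommSemiring R] (f : MvPolynomial σ R)
    (P Q : Finset σ) : Prop :=
  ∀ u : Finset σ → R, (∀ S ⊆ P, ∑ T ∈ Q.powerset, sqCoeff f (S ∪ T) * u T = 0) →
    ∀ T ⊆ Q, u T = 0

/-! ### Full rank and products in disjoint variables -/

section Semiring

variable {σ R : Type*} [CommSemiring R]

theorem sqCoeff_add (f g : MvPolynomial σ R) (S : Finset σ) :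
    sqCoeff (f + g) S = sqCoeff f S + sqCoeff g S := coeff_add _ _ _

theorem sqCoeff_sum {ι : Type*} (s : Finset ι) (f : ι → MvPolynomial σ R) (S : Finset σ) :
    sqCoeff (∑ i ∈ s, f i) S = ∑ i ∈ s, sqCoeff (f i) S := coeff_sum _ _ _

theorem sqCoeff_C_mul (a : R) (f : MvPolynomial σ R) (S : Finset σ) :
    sqCoeff (C a * f) S = a * sqCoeff f S := coeff_C_mul _ _ _

theorem support_subset_of_mem_supported {A : MvPolynomial σ R} {V : Set σ}
    (hA : A ∈ supported R V) {d : σ →₀ ℕ} (hd : coeff d A ≠ 0) : ↑d.support ⊆ V := by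
  rw [mem_supported] at hA
  intro x hx
  exact hA (by simpa using (mem_vars_iff_mem_support x).2 ⟨d, mem_support_iff.2 hd, hx⟩)

variable [DecidableEq σ]

theorem sqCoeff_rename {τ : Type*} [DecidableEq τ] (v : σ ↪ τ) (f : MvPolynomial σ R)
    (S : Finset σ) : sqCoeff (rename v f) (S.map v) = sqCoeff f S := by
  unfold sqCoeff
  rw [← coeff_rename_mapDomain v v.injective]
  congr 1
  ext x
  by_cases hx : x ∈ Set.range v
  · obtain ⟨y, rfl⟩ := hx
    rw [Finsupp.mapDomain_apply v.injective]
    simp [Finsupp.indicator_apply]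
  · rw [Finsupp.mapDomain_of_notMem_range _ _ hx, Finsupp.indicator_apply, dif_neg]
    intro h
    obtain ⟨y, -, hy⟩ := Finset.mem_map.1 h
    exact hx ⟨y, hy⟩

/-- The monomial of `S` factors in only one way into a monomial in `V` and one in `W`, so a single
term of the convolution survives. -/
theorem sqCoeff_mul {A B : MvPolynomial σ R} {V W : Finset σ}
    (hA : A ∈ supported R (V : Set σ)) (hB : B ∈ supported R (W : Set σ)) (h : Disjoint V W)
    {S : Finset σ} (hS : S ⊆ V ∪ W) :
    sqCoeff (A * B) S = sqCoeff A (S ∩ V) * sqCoeff B (S ∩ W) := by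
  unfold sqCoeff
  rw [coeff_mul]
  have key : ∀ x, x ∈ V → x ∉ W := fun x hx => Finset.disjoint_left.1 h hx
  refine Finset.sum_eq_single
    (Finsupp.indicator (S ∩ V) fun _ _ => 1, Finsupp.indicator (S ∩ W) fun _ _ => 1) ?_ ?_
  · rintro ⟨a, b⟩ hab hne
    by_contra hc
    have ha := support_subset_of_mem_supported hA (left_ne_zero_of_mul hc)
    have hb := support_subset_of_mem_supported hB (right_ne_zero_of_mul hc)
    rw [Finset.HasAntidiagonal.mem_antidiagonal] at hab
    have ha' : ∀ x, x ∉ V → a x = 0 := fun x hx => by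
      by_contra h0; exact hx (by simpa using ha (by simpa using h0))
    have hb' : ∀ x, x ∉ W → b x = 0 := fun x hx => by
      by_contra h0; exact hx (by simpa using hb (by simpa using h0))
    apply hne
    have hsum : ∀ x, a x + b x = if x ∈ S then 1 else 0 := fun x => by
      have := DFunLike.congr_fun hab x
      simpa [Finsupp.indicator_apply] using this
    ext x
    · have := hsum x
      simp only [Finsupp.indicator_apply, Finset.mem_inter]
      by_cases hV : x ∈ V
      · have := hb' x (key x hV)
        split_ifs at * <;> simp_all
      · simp [ha' x hV, hV]
    · have := hsum x
      simp only [Finsupp.indicator_apply, Finset.mem_inter]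
      by_cases hW : x ∈ W
      · have := ha' x (fun hV => key x hV hW)
        split_ifs at * <;> simp_all
      · simp [hb' x hW, hW]
  · intro hn
    refine absurd ?_ hn
    rw [Finset.HasAntidiagonal.mem_antidiagonal]
    ext x
    simp only [Finsupp.add_apply, Finsupp.indicator_apply, Finset.mem_inter]
    by_cases hx : x ∈ S
    · rcases Finset.mem_union.1 (hS hx) with hV | hW
      · simp [hx, hV, key x hV]
      · simp [hx, hW, show x ∉ V from fun hV => key x hV hW]
    · simp [hx]

theorem sum_powerset_union {M : Type*} [AddCommMonoid M] {P Q : Finset σ} (h : Disjoint P Q)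
    (F : Finset σ → M) :
    ∑ T ∈ (P ∪ Q).powerset, F T = ∑ T₁ ∈ P.powerset, ∑ T₂ ∈ Q.powerset, F (T₁ ∪ T₂) := by
  rw [← Finset.sum_product']
  symm
  refine Finset.sum_nbij' (fun T => T.1 ∪ T.2) (fun T => (T ∩ P, T ∩ Q)) ?_ ?_ ?_ ?_ ?_
  · rintro ⟨a, b⟩ hab
    simp only [Finset.mem_product, Finset.mem_powerset] at hab ⊢
    exact Finset.union_subset_union hab.1 hab.2
  · intro T _
    simp only [Finset.mem_product, Finset.mem_powerset]
    exact ⟨Finset.inter_subset_right, Finset.inter_subset_right⟩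
  · rintro ⟨a, b⟩ hab
    simp only [Finset.mem_product, Finset.mem_powerset] at hab
    rw [Finset.disjoint_left] at h
    ext x
    · have := @hab.1 x; have := @hab.2 x; have := @h x
      simp only [Finset.mem_inter, Finset.mem_union]; tauto
    · have := @hab.1 x; have := @hab.2 x; have := @h x
      simp only [Finset.mem_inter, Finset.mem_union]; tauto
  · intro T hT
    rw [Finset.mem_powerset] at hT
    simp only
    rw [← Finset.inter_union_distrib_left, Finset.inter_eq_left.2 hT]
  · intros; rfl

/-- The matrix of `A * B` is the Kronecker product of the matrices of `A` and `B`. Injectivity is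
checked one factor at a time: contracting a kernel vector with a row of `A` gives a kernel vector of
`B`, hence zero, and then injectivity of `A` applies. -/
theorem fullRank_mul {A B : MvPolynomial σ R} {V W P₁ Q₁ P₂ Q₂ : Finset σ}
    (hA : A ∈ supported R (V : Set σ)) (hB : B ∈ supported R (W : Set σ)) (h : Disjoint V W)
    (hP₁ : P₁ ⊆ V) (hQ₁ : Q₁ ⊆ V) (hP₂ : P₂ ⊆ W) (hQ₂ : Q₂ ⊆ W)
    (fA : FullRank A P₁ Q₁) (fB : FullRank B P₂ Q₂) :
    FullRank (A * B) (P₁ ∪ P₂) (Q₁ ∪ Q₂) := by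
  intro u hu T hT
  have h' := Finset.disjoint_left.1 h
  have inter : ∀ a b, a ⊆ V → b ⊆ W → (a ∪ b) ∩ V = a ∧ (a ∪ b) ∩ W = b := by
    intro a b ha hb
    constructor <;> ext x <;> have := @ha x <;> have := @hb x <;> have := @h' x <;>
      simp only [Finset.mem_inter, Finset.mem_union] <;> tauto
  have main : ∀ T₂ ⊆ Q₂, ∀ T₁ ⊆ Q₁, u (T₁ ∪ T₂) = 0 := by
    intro T₂ hT₂ T₁ hT₁
    refine fA (fun T₁ => u (T₁ ∪ T₂)) (fun S₁ hS₁ => ?_) T₁ hT₁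
    refine fB (fun T₂ => ∑ T₁ ∈ Q₁.powerset, sqCoeff A (S₁ ∪ T₁) * u (T₁ ∪ T₂))
      (fun S₂ hS₂ => ?_) T₂ hT₂
    have := hu (S₁ ∪ S₂) (Finset.union_subset_union hS₁ hS₂)
    rw [sum_powerset_union (Finset.disjoint_of_subset_left hQ₁
      (Finset.disjoint_of_subset_right hQ₂ h)), Finset.sum_comm] at this
    rw [← this]
    refine Finset.sum_congr rfl fun a ha => ?_
    rw [Finset.mul_sum]
    refine Finset.sum_congr rfl fun b hb => ?_
    rw [Finset.mem_powerset] at ha hb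
    have e := inter (S₁ ∪ b) (S₂ ∪ a) (Finset.union_subset (hS₁.trans hP₁) (hb.trans hQ₁))
      (Finset.union_subset (hS₂.trans hP₂) (ha.trans hQ₂))
    rw [Finset.union_union_union_comm, sqCoeff_mul hA hB h, e.1, e.2]
    · ring
    · exact Finset.union_subset_union (Finset.union_subset (hS₁.trans hP₁) (hb.trans hQ₁))
        (Finset.union_subset (hS₂.trans hP₂) (ha.trans hQ₂))
  have := main (T ∩ Q₂) Finset.inter_subset_right (T ∩ Q₁) Finset.inter_subset_right
  rwa [← Finset.inter_union_distrib_left, Finset.inter_eq_left.2 hT] at this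

theorem fullRank_one : FullRank (1 : MvPolynomial σ R) ∅ ∅ := by
  intro u hu T hT
  have := hu ∅ (Finset.Subset.refl _)
  rw [Finset.subset_empty.1 hT]
  have e : sqCoeff (1 : MvPolynomial σ R) (∅ ∪ ∅) = 1 := by
    rw [Finset.union_empty, sqCoeff, coeff_one, if_pos]
    ext x
    simp [Finsupp.indicator_apply]
  simpa only [Finset.powerset_empty, Finset.sum_singleton, e, one_mul] using this

/-- The matrix is the 2 × 2 identity: the coefficients of `1` and `x_i x_j` are on the diagonal. -/
theorem fullRank_one_add_X_mul_X {i j : σ} (hij : i ≠ j) :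
    FullRank (1 + X i * X j : MvPolynomial σ R) {i} {j} := by
  have hc : ∀ S : Finset σ, sqCoeff (1 + X i * X j : MvPolynomial σ R) S =
      (if S = ∅ then 1 else 0) + if S = {i, j} then 1 else 0 := by
    intro S
    have h1 : (X i * X j : MvPolynomial σ R) =
        monomial (Finsupp.single i 1 + Finsupp.single j 1) 1 := by
      simp [X, monomial_mul]
    have e1 : ((0 : σ →₀ ℕ) = Finsupp.indicator S fun _ _ => 1) ↔ S = ∅ := by
      rw [DFunLike.ext_iff, Finset.eq_empty_iff_forall_notMem]
      refine forall_congr' fun x => ?_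
      by_cases hx : x ∈ S <;> simp [Finsupp.indicator_apply, hx]
    have e2 : ((Finsupp.single i 1 + Finsupp.single j 1 : σ →₀ ℕ) =
        Finsupp.indicator S fun _ _ => 1) ↔ S = {i, j} := by
      rw [DFunLike.ext_iff, Finset.ext_iff]
      refine forall_congr' fun x => ?_
      simp only [Finsupp.add_apply, Finsupp.single_apply, Finsupp.indicator_apply,
        Finset.mem_insert, Finset.mem_singleton]
      by_cases hx : x ∈ S <;> by_cases hi : i = x <;> by_cases hj : j = x <;>
        simp_all [eq_comm]
    rw [sqCoeff_add, sqCoeff, coeff_one, sqCoeff, h1, coeff_monomial]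
    simp only [e1, e2]
  intro u hu T hT
  have hj : ({j} : Finset σ).powerset = {∅, {j}} := by
    ext T; simp [Finset.subset_singleton_iff]
  have hne : (∅ : Finset σ) ≠ {j} := (Finset.singleton_ne_empty j).symm
  have n1 : ({j} : Finset σ) ≠ {i, j} := fun h => by
    have : i ∈ ({j} : Finset σ) := h ▸ Finset.mem_insert_self _ _
    exact hij (Finset.mem_singleton.1 this)
  have n2 : ({i} : Finset σ) ≠ {i, j} := fun h => by
    have : j ∈ ({i} : Finset σ) := h ▸ by simp
    exact hij (Finset.mem_singleton.1 this).symm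
  have n3 : (∅ : Finset σ) ≠ {i, j} := (Finset.insert_ne_empty _ _).symm
  have h0 := hu ∅ (Finset.empty_subset _)
  have h1 := hu {i} (Finset.Subset.refl _)
  rw [hj, Finset.sum_pair hne] at h0 h1
  have n4 : ({i} ∪ {j} : Finset σ) = {i, j} := rfl
  simp only [Finset.empty_union, Finset.union_empty, hc, n1, n2, n3, n4, if_true, if_false,
    Finset.singleton_ne_empty, Finset.insert_ne_empty] at h0 h1
  simp only [add_zero, zero_add, one_mul, zero_mul] at h0 h1
  rcases Finset.subset_singleton_iff.1 hT with rfl | rfl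
  · exact h0
  · exact h1

end Semiring

/-! ### Full rank as a nonvanishing determinant -/

section Det

theorem exists_powerset_equiv {σ : Type*} {P Q : Finset σ} (h : P.card = Q.card) :
    Nonempty (Q.powerset ≃ P.powerset) := by
  rw [← Fintype.card_eq]
  simp [h]

variable {σ R : Type*} [DecidableEq σ] [CommRing R]

/-- The partial derivative matrix of `f`, made square by a bijection between the subsets of `Q` and
those of `P`. -/
noncomputable def pdMatrix (f : MvPolynomial σ R) {P Q : Finset σ}
    (e : Q.powerset ≃ P.powerset) : Matrix Q.powerset Q.powerset R :=
  fun T T' => sqCoeff f ((e T : Finset σ) ∪ T')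

theorem fullRank_iff_det_ne_zero [IsDomain R] (f : MvPolynomial σ R) {P Q : Finset σ}
    (e : Q.powerset ≃ P.powerset) : FullRank f P Q ↔ (pdMatrix f e).det ≠ 0 := by
  rw [Ne, ← Matrix.exists_mulVec_eq_zero_iff, not_exists]
  constructor
  · rintro hf v ⟨hv, hv0⟩
    apply hv
    have hu := hf (fun T => if h : T ∈ Q.powerset then v ⟨T, h⟩ else 0) ?_
    · ext T
      have := hu T (Finset.mem_powerset.1 T.2)
      rwa [dif_pos T.2] at this
    · intro S hS
      have := congrFun hv0 (e.symm ⟨S, Finset.mem_powerset.2 hS⟩)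
      simp only [Matrix.mulVec, dotProduct, pdMatrix, Equiv.apply_symm_apply] at this
      rw [← Finset.sum_coe_sort]
      simpa using this
  · intro h u hu T hT
    by_contra hne
    refine h (fun T => u T) ⟨fun h0 => hne ?_, ?_⟩
    · exact congrFun h0 ⟨T, Finset.mem_powerset.2 hT⟩
    · ext S
      have := hu (e S) (Finset.mem_powerset.1 (e S).2)
      rw [← Finset.sum_coe_sort] at this
      exact this

theorem det_pdMatrix_map {S : Type*} [CommRing S] (φ : R →+* S) (f : MvPolynomial σ R)
    {P Q : Finset σ} (e : Q.powerset ≃ P.powerset) :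
    (pdMatrix (map φ f) e).det = φ (pdMatrix f e).det := by
  rw [RingHom.map_det]
  congr 1

/-- A determinant that is nonzero after the specialization `φ` was nonzero before it, and remains so
under the injection `ψ`. Here `R` will be the polynomial ring in the `w`, `φ` an evaluation and `ψ`
the inclusion into the fraction field. -/
theorem fullRank_map_of_fullRank_map [IsDomain R] {K G : Type*} [Field K] [Field G]
    (φ : R →+* K) (ψ : R →+* G) (hψ : Function.Injective ψ) (f : MvPolynomial σ R)
    {P Q : Finset σ} (h : P.card = Q.card) (hf : FullRank (map φ f) P Q) :
    FullRank (map ψ f) P Q := by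
  obtain ⟨e⟩ := exists_powerset_equiv h
  rw [fullRank_iff_det_ne_zero _ e] at hf ⊢
  rw [det_pdMatrix_map] at hf
  rw [det_pdMatrix_map, Ne, map_eq_zero_iff ψ hψ]
  exact fun h0 => hf (by rw [h0, map_zero])

/-- The determinant for `z * A + B` is a polynomial in `z` whose coefficient in the top possible
degree is the determinant for `A`; being nonzero, it has a non-root in an infinite field. -/
theorem exists_fullRank_C_mul_add {K : Type*} [Field K] [Infinite K] {A : MvPolynomial σ K}
    (B : MvPolynomial σ K) {P Q : Finset σ} (h : P.card = Q.card) (hA : FullRank A P Q) :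
    ∃ z : K, FullRank (C z * A + B) P Q := by
  obtain ⟨e⟩ := exists_powerset_equiv h
  rw [fullRank_iff_det_ne_zero _ e] at hA
  set p : Polynomial K := ((Polynomial.X : Polynomial K) • (pdMatrix A e).map Polynomial.C +
    (pdMatrix B e).map Polynomial.C).det with hp
  have hp0 : p ≠ 0 := by
    intro h0
    apply hA
    rw [← Polynomial.coeff_det_X_add_C_card (pdMatrix A e) (pdMatrix B e), ← hp, h0,
      Polynomial.coeff_zero]
  obtain ⟨z, hz⟩ := Polynomial.exists_eval_ne_zero_of_natDegree_lt_card p hp0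
    (lt_of_lt_of_le Cardinal.natCast_lt_aleph0 (Cardinal.aleph0_le_mk K))
  refine ⟨z, (fullRank_iff_det_ne_zero _ e).2 ?_⟩
  rw [← Polynomial.coe_evalRingHom, hp, RingHom.map_det] at hz
  convert hz using 2
  ext T T'
  simp [pdMatrix, sqCoeff_add, sqCoeff_C_mul, mul_comm z]

end Det

theorem fullRank_of_rename {σ τ R : Type*} [DecidableEq σ] [DecidableEq τ] [CommSemiring R]
    (v : σ ↪ τ) {f : MvPolynomial σ R} {P Q : Finset σ}
    (h : FullRank (rename v f) (P.map v) (Q.map v)) : FullRank f P Q := by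
  intro u hu T hT
  have := h (fun T => u (T.preimage v v.injective.injOn)) (fun S hS => ?_) (T.map v)
    (Finset.map_subset_map.2 hT)
  · simpa using this
  · obtain ⟨S, rfl⟩ : ∃ S', S = Finset.map v S' := by
      obtain ⟨S', -, h'⟩ := Finset.subset_map_iff.1 hS
      exact ⟨S', h'⟩
    rw [← hu S (Finset.map_subset_map.1 hS)]
    symm
    refine Finset.sum_nbij (fun T => T.map v) ?_ ?_ ?_ ?_
    · intro T hT
      simpa using hT
    · exact (Finset.map_injective v).injOn
    · intro T hT
      obtain ⟨T', h1, h2⟩ := Finset.subset_map_iff.1 (Finset.mem_powerset.1 (Finset.mem_coe.1 hT))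
      exact ⟨T', by simpa using h1, h2.symm⟩
    · intro T _
      simp only [← Finset.map_union, sqCoeff_rename, Finset.preimage_map]

/-! ### The recursion: locality, base change and supports -/

/-- Locality in the indices is what allows the parameters of disjoint subintervals to be chosen
independently. -/
theorem gRec_congr {R : Type*} [CommSemiring R] {x x' : ℕ → R} {w w' : ℕ → ℕ → ℕ → R} {i j : ℕ}
    (hx : ∀ p, i ≤ p → p ≤ j → x p = x' p)
    (hw : ∀ a b c, i ≤ a → a ≤ b → b ≤ c → c ≤ j → w a b c = w' a b c) :
    gRec x w i j = gRec x' w' i j := by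
  induction h : j + 1 - i using Nat.strong_induction_on generalizing i j with
  | _ n ih =>
    subst h
    by_cases hij : i ≤ j
    · have IH : ∀ i' j', i ≤ i' → j' ≤ j → j' + 1 - i' < j + 1 - i →
          gRec x w i' j' = gRec x' w' i' j' := fun i' j' h1 h2 h3 =>
        ih _ h3 (fun p hp hp' => hx p (by omega) (by omega))
          (fun a b c ha hab hbc hc => hw a b c (by omega) hab hbc (by omega)) rfl
      rw [gRec_of_le _ _ hij, gRec_of_le _ _ hij, hx i le_rfl hij, hx j hij le_rfl,
        IH (i + 1) (j - 1) (by omega) (by omega) (by omega)]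
      congr 1
      refine Finset.sum_congr rfl fun k hk => ?_
      simp only [Finset.mem_filter, Finset.mem_Icc] at hk
      rw [hw i k j le_rfl (by omega) (by omega) le_rfl,
        IH i k (by omega) (by omega) (by omega), IH (k + 1) j (by omega) (by omega) (by omega)]
    · rw [gRec_of_lt _ _ (by omega), gRec_of_lt _ _ (by omega)]

theorem map_gRec {R S : Type*} [CommSemiring R] [CommSemiring S] (φ : R →+* S) (x : ℕ → R)
    (w : ℕ → ℕ → ℕ → R) (i j : ℕ) :
    φ (gRec x w i j) = gRec (fun p => φ (x p)) (fun a b c => φ (w a b c)) i j := by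
  induction h : j + 1 - i using Nat.strong_induction_on generalizing i j with
  | _ n ih =>
    subst h
    by_cases hij : i ≤ j
    · rw [gRec_of_le _ _ hij, gRec_of_le _ _ hij, map_add, map_mul, map_add, map_one, map_mul,
        map_sum, ih _ (by omega) (i + 1) (j - 1) rfl]
      congr 1
      refine Finset.sum_congr rfl fun k hk => ?_
      simp only [Finset.mem_filter, Finset.mem_Icc] at hk
      rw [map_mul, map_mul, ih _ (by omega) i k rfl, ih _ (by omega) (k + 1) j rfl]
    · rw [gRec_of_lt _ _ (by omega), gRec_of_lt _ _ (by omega), map_one]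

theorem gRec_mem_supported {K : Type*} [CommSemiring K] (w : ℕ → ℕ → ℕ → K) (i j : ℕ) :
    gRec X (fun a b c => C (w a b c)) i j ∈ supported K (Icc i j : Set ℕ) := by
  induction h : j + 1 - i using Nat.strong_induction_on generalizing i j with
  | _ n ih =>
    subst h
    by_cases hij : i ≤ j
    · have IH : ∀ i' j', i ≤ i' → j' ≤ j → j' + 1 - i' < j + 1 - i →
          gRec X (fun a b c => C (w a b c)) i' j' ∈ supported K (Icc i j : Set ℕ) :=
        fun i' j' h1 h2 h3 => supported_mono
          (by exact_mod_cast Finset.Icc_subset_Icc h1 h2) (ih _ h3 i' j' rfl)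
      have hX : ∀ p ∈ Icc i j, (X p : MvPolynomial ℕ K) ∈ supported K (Icc i j : Set ℕ) :=
        fun p hp => Algebra.subset_adjoin ⟨p, by exact_mod_cast hp, rfl⟩
      rw [gRec_of_le _ _ hij]
      refine add_mem (mul_mem (add_mem (one_mem _) (mul_mem (hX _ ?_) (hX _ ?_)))
        (IH _ _ (by omega) (by omega) (by omega))) (sum_mem fun k hk => ?_)
      · simp [hij]
      · simp [hij]
      · simp only [Finset.mem_filter, Finset.mem_Icc] at hk
        exact mul_mem (mul_mem (Subalgebra.algebraMap_mem _ _)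
          (IH _ _ (by omega) (by omega) (by omega))) (IH _ _ (by omega) (by omega) (by omega))
    · rw [gRec_of_lt _ _ (by omega)]
      exact one_mem _

/-! ### Balanced subintervals and full rank of the recursion -/

/-- A discrete intermediate value theorem. -/
theorem exists_eq_zero_of_pos_of_neg {h : ℕ → ℤ} (hstep : ∀ k, h k - 1 ≤ h (k + 1)) {a b : ℕ}
    (hab : a ≤ b) (ha : 0 < h a) (hb : h b < 0) : ∃ k, a < k ∧ k < b ∧ h k = 0 := by
  have hex : ∃ k, a ≤ k ∧ h k ≤ 0 := ⟨b, hab, hb.le⟩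
  have hs := Nat.find_spec hex
  have hle : Nat.find hex ≤ b := Nat.find_min' hex ⟨hab, hb.le⟩
  set k := Nat.find hex with hk
  have hak : a < k := lt_of_le_of_ne hs.1 fun h0 => by rw [← h0] at hs; omega
  have hm := Nat.find_min hex (m := k - 1) (by omega)
  have := hstep (k - 1)
  rw [show k - 1 + 1 = k by omega] at this
  have h0 : h k = 0 := by
    have : ¬ h (k - 1) ≤ 0 := fun h' => hm ⟨by omega, h'⟩
    omega
  exact ⟨k, hak, lt_of_le_of_ne hle fun h' => by rw [h'] at h0; omega, h0⟩

/-- `#Y - #Yᶜ` on the interval `[i, j]`. -/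
def excess (Y : Finset ℕ) (i j : ℕ) : ℤ :=
  ∑ p ∈ Icc i j, if p ∈ Y then 1 else -1

theorem excess_eq (Y : Finset ℕ) (i j : ℕ) :
    excess Y i j = ((Icc i j ∩ Y).card : ℤ) - (Icc i j \ Y).card := by
  unfold excess
  rw [Finset.sum_ite, Finset.filter_mem_eq_inter, Finset.filter_notMem_eq_sdiff]
  simp [sub_eq_add_neg]

theorem excess_append (Y : Finset ℕ) {i k j : ℕ} (h1 : i ≤ k + 1) (h2 : k ≤ j) :
    excess Y i j = excess Y i k + excess Y (k + 1) j := by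
  unfold excess
  rw [← Finset.sum_union]
  · congr 1
    ext p
    simp only [Finset.mem_union, Finset.mem_Icc]
    omega
  · rw [Finset.disjoint_left]
    intro p hp hp'
    simp only [Finset.mem_Icc] at hp hp'
    omega

theorem excess_self (Y : Finset ℕ) (i : ℕ) : excess Y i i = if i ∈ Y then 1 else -1 := by
  simp [excess]

theorem even_of_excess_eq_zero {Y : Finset ℕ} {i j : ℕ} (h : excess Y i j = 0) :
    Even (j + 1 - i) := by
  rw [excess_eq] at h
  have := Finset.card_inter_add_card_sdiff (Icc i j) Y
  rw [Nat.card_Icc] at this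
  exact ⟨(Icc i j ∩ Y).card, by omega⟩

/-- With both endpoints on the same side, the walk `excess Y i ·` is `±1` at `i` and has the
opposite value at `j - 1`; its steps are `±1`, so it vanishes in between. The bound `k < j - 1`
places `k` in the range of the sum in the recursion. -/
theorem exists_excess_eq_zero {Y : Finset ℕ} {i j : ℕ} (hij : i < j) (h : excess Y i j = 0)
    (hY : i ∈ Y ↔ j ∈ Y) : ∃ k, i < k ∧ k < j - 1 ∧ excess Y i k = 0 := by
  have hj := excess_append Y (i := i) (k := j - 1) (j := j) (by omega) (by omega)
  rw [show j - 1 + 1 = j by omega, h, excess_self] at hj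
  have hi := excess_self Y i
  have hstep : ∀ k, i ≤ k + 1 →
      excess Y i (k + 1) = excess Y i k + if k + 1 ∈ Y then 1 else -1 := fun k hk => by
    rw [excess_append Y (k := k) (by omega) (by omega), excess_self]
  by_cases hiY : i ∈ Y
  · have hjY := hY.1 hiY
    simp only [hiY, hjY, if_true] at hi hj
    refine exists_eq_zero_of_pos_of_neg (h := excess Y i) (fun k => ?_) (by omega) (by omega)
      (by omega)
    by_cases hk : i ≤ k + 1
    · rw [hstep k hk]; split_ifs <;> omega
    · simp [excess, Finset.Icc_eq_empty_of_lt (show k < i by omega),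
        Finset.Icc_eq_empty_of_lt (show k + 1 < i by omega)]
  · have hjY : j ∉ Y := fun h => hiY (hY.2 h)
    simp only [hiY, hjY, if_false] at hi hj
    have hneg : ∀ k, -excess Y i k - 1 ≤ -excess Y i (k + 1) := by
      intro k
      by_cases hk : i ≤ k + 1
      · rw [hstep k hk]; split_ifs <;> omega
      · simp [excess, Finset.Icc_eq_empty_of_lt (show k < i by omega),
          Finset.Icc_eq_empty_of_lt (show k + 1 < i by omega)]
    obtain ⟨k, h1, h2, h3⟩ := exists_eq_zero_of_pos_of_neg (h := fun k => -excess Y i k)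
      hneg (a := i) (b := j - 1) (by omega) (by omega) (by omega)
    exact ⟨k, h1, h2, by omega⟩

theorem Icc_inter_split (Y : Finset ℕ) {i k j : ℕ} (h1 : i ≤ k) (h2 : k ≤ j) :
    Icc i j ∩ Y = (Icc i k ∩ Y) ∪ (Icc (k + 1) j ∩ Y) ∧
      Icc i j \ Y = (Icc i k \ Y) ∪ (Icc (k + 1) j \ Y) := by
  constructor <;> ext p <;>
    simp only [Finset.mem_inter, Finset.mem_union, Finset.mem_sdiff, Finset.mem_Icc] <;>
    by_cases hp : p ∈ Y <;> simp only [hp, and_true, not_true, not_false_eq_true, and_false,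
      or_false] <;> omega

/-- For a balanced partition, some values of the parameters `w` give the polynomial `g_{i,j}` full
rank. -/
theorem exists_fullRank_gRec {K : Type*} [Field K] [Infinite K] (Y : Finset ℕ) (i j : ℕ)
    (h : excess Y i j = 0) :
    ∃ w : ℕ → ℕ → ℕ → K,
      FullRank (gRec X (fun a b c => C (w a b c)) i j) (Icc i j ∩ Y) (Icc i j \ Y) := by
  induction hn : j + 1 - i using Nat.strong_induction_on generalizing i j with
  | _ n ih =>
    subst hn
    rcases lt_or_ge j i with hji | hij
    · refine ⟨0, ?_⟩
      rw [gRec_of_lt _ _ hji, Finset.Icc_eq_empty_of_lt hji, Finset.empty_inter,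
        Finset.empty_sdiff]
      exact fullRank_one
    have hlt : i < j := by
      have := even_of_excess_eq_zero h
      rcases hij.lt_or_eq with h' | rfl
      · exact h'
      · simp at this
    by_cases hY : i ∈ Y ↔ j ∈ Y
    · obtain ⟨k, hik, hkj, hk⟩ := exists_excess_eq_zero hlt h hY
      have hk' : excess Y (k + 1) j = 0 := by
        have := excess_append Y (i := i) (k := k) (j := j) (by omega) (by omega)
        omega
      obtain ⟨w₁, hw₁⟩ := ih _ (by omega) i k hk rfl
      obtain ⟨w₂, hw₂⟩ := ih _ (by omega) (k + 1) j hk' rfl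
      -- Triples inside `[i, k]` follow `w₁`, all others `w₂`, except that `(i, k, j)` carries the
      -- free parameter `z`. No proper subinterval sees that triple, so `g_{i,j}` is affine in `z`
      -- with slope `g_{i,k} * g_{k+1,j}`.
      set W : K → ℕ → ℕ → ℕ → K := fun z a b c =>
        if a = i ∧ b = k ∧ c = j then z else if c ≤ k then w₁ a b c else w₂ a b c with hW
      have hsplit : ∀ z, gRec X (fun a b c => C (W z a b c)) i j =
          C z * (gRec X (fun a b c => C (w₁ a b c)) i k *
            gRec X (fun a b c => C (w₂ a b c)) (k + 1) j) +
          gRec X (fun a b c => C (W 0 a b c)) i j := by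
        intro z
        have hmem : k ∈ (Finset.Icc (i + 1) (j - 2)).filter (fun k => Even (k + 1 - i)) := by
          simp only [Finset.mem_filter, Finset.mem_Icc]
          exact ⟨by omega, even_of_excess_eq_zero hk⟩
        have h1 : ∀ z, gRec X (fun a b c => C (W z a b c)) i k =
            gRec X (fun a b c => C (w₁ a b c)) i k := fun z =>
          gRec_congr (fun _ _ _ => rfl) fun a b c _ _ _ _ => by
            simp only [hW]
            rw [if_neg (by omega), if_pos (by omega)]
        have h2 : ∀ z, gRec X (fun a b c => C (W z a b c)) (k + 1) j =
            gRec X (fun a b c => C (w₂ a b c)) (k + 1) j := fun z =>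
          gRec_congr (fun _ _ _ => rfl) fun a b c _ _ _ _ => by
            simp only [hW]
            rw [if_neg (by omega), if_neg (by omega)]
        have h3 : ∀ i' j', i ≤ i' → j' ≤ j → ¬ (i' = i ∧ j' = j) →
            gRec X (fun a b c => C (W z a b c)) i' j' =
              gRec X (fun a b c => C (W 0 a b c)) i' j' := fun i' j' _ _ _ =>
          gRec_congr (fun _ _ _ => rfl) fun a b c _ _ _ _ => by
            simp only [hW, show ¬ (a = i ∧ b = k ∧ c = j) by omega, if_false]
        rw [gRec_of_le _ _ hij, gRec_of_le _ _ hij, h3 (i + 1) (j - 1) (by omega) (by omega)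
          (by omega), ← Finset.add_sum_erase _ _ hmem, ← Finset.add_sum_erase _ _ hmem, h1, h2,
          h1, h2, Finset.sum_congr rfl (g := fun k' => C (W 0 i k' j) *
            gRec X (fun a b c => C (W 0 a b c)) i k' *
            gRec X (fun a b c => C (W 0 a b c)) (k' + 1) j)]
        · simp only [hW]
          simp only [and_self, if_true, map_zero]
          ring
        · intro k' hk'
          simp only [Finset.mem_erase, Finset.mem_filter, Finset.mem_Icc] at hk'
          rw [h3 i k' le_rfl (by omega) (by omega), h3 (k' + 1) j (by omega) le_rfl (by omega)]
          congr 3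
          simp only [hW, hk'.1, false_and, and_false, if_false]
      have hdisj : Disjoint (Icc i k) (Icc (k + 1) j) := by
        rw [Finset.disjoint_left]
        intro p hp hp'
        simp only [Finset.mem_Icc] at hp hp'
        omega
      have hprod := fullRank_mul (gRec_mem_supported w₁ i k) (gRec_mem_supported w₂ (k + 1) j)
        hdisj Finset.inter_subset_left Finset.sdiff_subset Finset.inter_subset_left
        Finset.sdiff_subset hw₁ hw₂
      obtain ⟨s1, s2⟩ := Icc_inter_split Y (i := i) (k := k) (j := j) (by omega) (by omega)
      rw [← s1, ← s2] at hprod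
      obtain ⟨z, hz⟩ := exists_fullRank_C_mul_add (gRec X (fun a b c => C (W 0 a b c)) i j)
        (by rw [excess_eq] at h; omega) hprod
      exact ⟨W z, by rw [hsplit]; exact hz⟩
    · have e1 := excess_append Y (i := i) (k := i) (j := j) (by omega) hij
      have e2 := excess_append Y (i := i + 1) (k := j - 1) (j := j) (by omega) (by omega)
      rw [show j - 1 + 1 = j by omega, excess_self] at e2
      rw [excess_self] at e1
      obtain ⟨w₀, hw₀⟩ := ih _ (by omega) (i + 1) (j - 1)
        (by by_cases hi : i ∈ Y <;> by_cases hj : j ∈ Y <;> simp_all) rfl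
      -- Endpoints on opposite sides: setting every `w_{i,·,·}` to zero removes the sum and leaves
      -- only `(1 + x_i x_j) * g_{i+1,j-1}`.
      set w : ℕ → ℕ → ℕ → K := fun a b c => if a = i then 0 else w₀ a b c with hw
      refine ⟨w, ?_⟩
      have hg : gRec X (fun a b c => C (w a b c)) i j =
          (1 + X i * X j) * gRec X (fun a b c => C (w₀ a b c)) (i + 1) (j - 1) := by
        rw [gRec_of_le _ _ hij, Finset.sum_eq_zero, add_zero]
        · congr 1
          refine gRec_congr (fun _ _ _ => rfl) fun a b c _ _ _ _ => ?_
          simp only [hw]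
          rw [if_neg (by omega)]
        · intro k _
          simp [hw]
      rw [hg]
      have hA : (1 + X i * X j : MvPolynomial ℕ K) ∈ supported K (({i, j} : Finset ℕ) : Set ℕ) :=
        add_mem (one_mem _) (mul_mem (Algebra.subset_adjoin ⟨i, by simp, rfl⟩)
          (Algebra.subset_adjoin ⟨j, by simp, rfl⟩))
      have hdisj : Disjoint {i, j} (Icc (i + 1) (j - 1)) := by
        rw [Finset.disjoint_left]
        intro p hp hp'
        simp only [Finset.mem_Icc, Finset.mem_insert, Finset.mem_singleton] at hp hp'
        omega
      have hIcc : Icc i j = {i, j} ∪ Icc (i + 1) (j - 1) := by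
        ext p
        simp only [Finset.mem_Icc, Finset.mem_insert, Finset.mem_singleton, Finset.mem_union]
        omega
      rw [hIcc, Finset.union_inter_distrib_right, Finset.union_sdiff_distrib]
      refine fullRank_mul hA (gRec_mem_supported w₀ _ _) hdisj Finset.inter_subset_left
        Finset.sdiff_subset Finset.inter_subset_left Finset.sdiff_subset ?_ hw₀
      by_cases hi : i ∈ Y
      · have hj : j ∉ Y := fun hj => hY (iff_of_true hi hj)
        rw [show ({i, j} : Finset ℕ) ∩ Y = {i} by grind, show ({i, j} : Finset ℕ) \ Y = {j} by grind]
        exact fullRank_one_add_X_mul_X hlt.ne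
      · have hj : j ∈ Y := by_contra fun hj => hY (iff_of_false hi hj)
        rw [show ({i, j} : Finset ℕ) ∩ Y = {j} by grind, show ({i, j} : Finset ℕ) \ Y = {i} by grind,
          mul_comm (X i)]
        exact fullRank_one_add_X_mul_X hlt.ne'

/-! ### Counting sets that are nearly balanced on prefixes -/

theorem sq_centralBinom_mul_le (a : ℕ) : a.centralBinom ^ 2 * (2 * a + 1) ≤ 16 ^ a := by
  induction a with
  | zero => simp
  | succ a ih =>
    have h := Nat.succ_mul_centralBinom_succ a
    have : (a + 1) ^ 2 * ((a + 1).centralBinom ^ 2 * (2 * (a + 1) + 1)) ≤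
        (a + 1) ^ 2 * 16 ^ (a + 1) := by
      calc (a + 1) ^ 2 * ((a + 1).centralBinom ^ 2 * (2 * (a + 1) + 1))
          = ((a + 1) * (a + 1).centralBinom) ^ 2 * (2 * a + 3) := by ring
        _ = 4 * ((2 * a + 1) * (2 * a + 3)) * (a.centralBinom ^ 2 * (2 * a + 1)) := by
            rw [h]; ring
        _ ≤ 4 * (4 * (a + 1) ^ 2) * 16 ^ a := by
            have : (2 * a + 1) * (2 * a + 3) ≤ 4 * (a + 1) ^ 2 := by nlinarith
            gcongr
        _ = (a + 1) ^ 2 * 16 ^ (a + 1) := by ring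
    exact Nat.le_of_mul_le_mul_left this (by positivity)

/-- In a block of `4 * D ^ 2` elements a prescribed cardinality has probability at most `1 / (2 *
D)`, so `D` prescribed cardinalities together have probability at most `1 / 2`. This is the reason
for the block length. -/
theorem two_mul_mul_centralBinom_le (D : ℕ) :
    2 * (D * (2 * D ^ 2).centralBinom) ≤ 2 ^ (2 * (2 * D ^ 2)) := by
  have h := sq_centralBinom_mul_le (2 * D ^ 2)
  rw [← Nat.pow_le_pow_iff_left (n := 2) (by norm_num)]
  calc (2 * (D * (2 * D ^ 2).centralBinom)) ^ 2
      = (2 * D ^ 2).centralBinom ^ 2 * (4 * D ^ 2) := by ring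
    _ ≤ (2 * D ^ 2).centralBinom ^ 2 * (2 * (2 * D ^ 2) + 1) := by gcongr; omega
    _ ≤ 16 ^ (2 * D ^ 2) := h
    _ = (2 ^ (2 * (2 * D ^ 2))) ^ 2 := by
        rw [← pow_mul, show (16 : ℕ) = 2 ^ 4 by norm_num, ← pow_mul]; ring_nf

/-- `Y` splits `U` into parts whose sizes differ by less than `D`. -/
def NearlyBalanced {σ : Type*} [DecidableEq σ] (D : ℕ) (Y U : Finset σ) : Prop :=
  |2 * ((Y ∩ U).card : ℤ) - U.card| < D

instance {σ : Type*} [DecidableEq σ] (D : ℕ) (Y U : Finset σ) :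
    Decidable (NearlyBalanced D Y U) := by
  unfold NearlyBalanced; infer_instance

theorem card_filter_powerset_le {σ : Type*} (B : Finset σ) (a D : ℕ) (hB : B.card = 2 * a)
    (r c : ℤ) : (B.powerset.filter fun T => |2 * (r + T.card) - c| < D).card ≤
      D * a.centralBinom := by
  -- The condition confines `2 * #T` to an open interval of length `2 * D`, so `#T` takes at most
  -- `D` values.
  set J : Finset ℤ := Finset.Icc ((c - D - 2 * r) / 2 + 1) ((c - D - 2 * r) / 2 + D) with hJ
  have hJc : J.card = D := by rw [hJ, Int.card_Icc]; omega
  rw [mul_comm, ← hJc]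
  refine Finset.card_le_mul_card_image_of_maps_to (f := fun T : Finset σ => (T.card : ℤ)) ?_ _ ?_
  · intro T hT
    have := abs_lt.1 (Finset.mem_filter.1 hT).2
    rw [hJ, Finset.mem_Icc]
    omega
  · intro j _
    by_cases hj : 0 ≤ j
    · calc _ ≤ (B.powersetCard j.toNat).card := by
            refine Finset.card_le_card fun T hT => ?_
            simp only [Finset.mem_filter, Finset.mem_powerset] at hT
            rw [Finset.mem_powersetCard]
            exact ⟨hT.1.1, by omega⟩
        _ ≤ _ := by
            rw [Finset.card_powersetCard, hB]
            exact Nat.choose_le_centralBinom _ _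
    · rw [Finset.card_eq_zero.2]
      · exact Nat.zero_le _
      · refine Finset.filter_eq_empty_iff.2 fun T _ h => ?_
        omega

/-- Once `Y ∩ U t` is fixed, near balance on `U (t + 1)` restricts the number of elements in the new
block to `D` values, each attained by at most `a.centralBinom` subsets. -/
theorem card_nearlyBalanced_powerset_le {σ : Type*} [DecidableEq σ] (U : ℕ → Finset σ)
    (hU : Monotone U) (a D t : ℕ) (hc : ∀ k ≤ t, (U k).card = k * (2 * a)) :
    ((U t).powerset.filter fun Y => ∀ k ≤ t, NearlyBalanced D Y (U k)).card ≤
      (D * a.centralBinom) ^ t := by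
  induction t with
  | zero =>
    have : U 0 = ∅ := by rw [← Finset.card_eq_zero, hc 0 le_rfl, zero_mul]
    refine (Finset.card_filter_le _ _).trans ?_
    simp [this]
  | succ t ih =>
    have ih := ih fun k hk => hc k (by omega)
    have hsub : U t ⊆ U (t + 1) := hU (Nat.le_succ t)
    rw [pow_succ']
    refine (Finset.card_le_mul_card_image_of_maps_to (f := fun Y => Y ∩ U t)
      (t := (U t).powerset.filter fun Y => ∀ k ≤ t, NearlyBalanced D Y (U k)) ?_
      (D * a.centralBinom) ?_).trans (Nat.mul_le_mul_left _ ih)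
    · intro Y hY
      rw [Finset.mem_filter] at hY ⊢
      refine ⟨Finset.mem_powerset.2 Finset.inter_subset_right, fun k hk => ?_⟩
      have := hY.2 k (by omega)
      unfold NearlyBalanced at this ⊢
      rwa [Finset.inter_assoc, Finset.inter_eq_right.2 (hU hk)]
    · intro Y' hY'
      have hY'U : Y' ⊆ U t := Finset.mem_powerset.1 (Finset.mem_filter.1 hY').1
      refine le_trans ?_ (card_filter_powerset_le (U (t + 1) \ U t) a D ?_ Y'.card
        (U (t + 1)).card)
      · refine Finset.card_le_card_of_injOn (fun Y => Y \ U t) ?_ ?_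
        · intro Y hY
          simp only [Finset.coe_filter, Finset.mem_filter, Finset.mem_powerset,
            Set.mem_ofPred_eq] at hY ⊢
          refine ⟨Finset.sdiff_subset_sdiff hY.1.1 (Finset.Subset.refl _), ?_⟩
          have h1 := hY.1.2 (t + 1) le_rfl
          have h2 := Finset.card_inter_add_card_sdiff Y (U t)
          unfold NearlyBalanced at h1
          rw [Finset.inter_eq_left.2 hY.1.1, ← h2, hY.2] at h1
          push_cast at h1
          exact h1
        · intro Y₁ h₁ Y₂ h₂ h
          simp only [Finset.coe_filter, Finset.mem_filter, Set.mem_ofPred_eq] at h₁ h₂ h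
          rw [← Finset.sdiff_union_inter Y₁ (U t), ← Finset.sdiff_union_inter Y₂ (U t), h, h₁.2,
            h₂.2]
      · rw [Finset.card_sdiff_of_subset hsub, hc _ le_rfl, hc _ (by omega), Nat.succ_mul]
        omega

/-- Each of the `t` blocks costs a factor 2; elements outside `U t` are free. -/
theorem two_pow_mul_card_nearlyBalanced_le {σ : Type*} [Fintype σ] [DecidableEq σ]
    (U : ℕ → Finset σ) (hU : Monotone U) (D t : ℕ)
    (hc : ∀ k ≤ t, (U k).card = k * (2 * (2 * D ^ 2))) :
    2 ^ t * (univ.filter fun Y => ∀ k ≤ t, NearlyBalanced D Y (U k)).card ≤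
      2 ^ Fintype.card σ := by
  have h1 : (univ.filter fun Y => ∀ k ≤ t, NearlyBalanced D Y (U k)).card ≤
      ((U t).powerset.filter fun Y => ∀ k ≤ t, NearlyBalanced D Y (U k)).card *
        (U t)ᶜ.powerset.card := by
    rw [← Finset.card_product]
    refine Finset.card_le_card_of_injOn (fun Y => (Y ∩ U t, Y \ U t)) ?_ ?_
    · intro Y hY
      simp only [Finset.coe_filter, Finset.mem_univ, true_and, Set.mem_ofPred_eq] at hY
      simp only [Finset.coe_product, Set.mem_prod, Finset.mem_coe, Finset.mem_filter,
        Finset.mem_powerset]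
      refine ⟨⟨Finset.inter_subset_right, fun k hk => ?_⟩, ?_⟩
      · have := hY k hk
        unfold NearlyBalanced at this ⊢
        rwa [Finset.inter_assoc, Finset.inter_eq_right.2 (hU hk)]
      · intro x hx
        simp only [Finset.mem_sdiff] at hx
        simpa using hx.2
    · intro Y₁ h₁ Y₂ h₂ h
      simp only [Prod.mk.injEq] at h
      rw [← Finset.sdiff_union_inter Y₁ (U t), ← Finset.sdiff_union_inter Y₂ (U t), h.1, h.2]
  have h2 := card_nearlyBalanced_powerset_le U hU (2 * D ^ 2) D t hc
  have h3 : (U t).card + (U t)ᶜ.card = Fintype.card σ := Finset.card_add_card_compl _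
  calc _ ≤ 2 ^ t * ((D * (2 * D ^ 2).centralBinom) ^ t * 2 ^ (U t)ᶜ.card) := by
        rw [Finset.card_powerset] at h1
        exact Nat.mul_le_mul_left _ (h1.trans (Nat.mul_le_mul_right _ h2))
    _ = (2 * (D * (2 * D ^ 2).centralBinom)) ^ t * 2 ^ (U t)ᶜ.card := by
        rw [mul_pow 2]; ring
    _ ≤ (2 ^ (2 * (2 * D ^ 2))) ^ t * 2 ^ (U t)ᶜ.card := by
        gcongr
        exact two_mul_mul_centralBinom_le D
    _ = 2 ^ Fintype.card σ := by
        rw [← h3, hc t le_rfl, ← pow_mul, ← pow_add, mul_comm t]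

/-- The sublevel sets of an injective function to `ℕ` attain every cardinality. -/
theorem exists_card_sublevel_eq {σ : Type*} [Fintype σ] [DecidableEq σ] {key : σ → ℕ}
    (hkey : Function.Injective key) {k : ℕ} (hk : k ≤ Fintype.card σ) :
    ∃ l, (univ.filter fun x => key x < l).card = k := by
  induction k with
  | zero => exact ⟨0, by simp⟩
  | succ k ih =>
    classical
    obtain ⟨L, hL⟩ : ∃ L, ∀ x, key x < L := by
      obtain ⟨M, hM⟩ := (Set.finite_range key).bddAbove
      exact ⟨M + 1, fun x => Nat.lt_succ_of_le (hM ⟨x, rfl⟩)⟩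
    have hex : ∃ l, k + 1 ≤ (univ.filter fun x => key x < l).card :=
      ⟨L, by simpa [hL] using hk⟩
    refine ⟨Nat.find hex, le_antisymm ?_ (Nat.find_spec hex)⟩
    rcases h : Nat.find hex with _ | l
    · simp
    · have h1 := Nat.find_min hex (m := l) (by omega)
      have h2 : (univ.filter fun x => key x < l + 1).card ≤
          (univ.filter fun x => key x < l).card + (univ.filter fun x => key x = l).card := by
        refine le_trans (Finset.card_le_card fun x hx => ?_) (Finset.card_union_le _ _)
        simp only [Finset.mem_filter, Finset.mem_univ, true_and, Finset.mem_union] at hx ⊢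
        omega
      have h3 : (univ.filter fun x => key x = l).card ≤ 1 :=
        Finset.card_le_one.2 fun x hx y hy => by
          simp only [Finset.mem_filter, Finset.mem_univ, true_and] at hx hy
          exact hkey (hx.trans hy.symm)
      omega

/-- Few sets are nearly balanced on all sublevel sets of an injective function. -/
theorem two_pow_mul_card_nearlyBalanced_sublevel_le {σ : Type*} [Fintype σ] [DecidableEq σ]
    {key : σ → ℕ} (hkey : Function.Injective key) (D t : ℕ)
    (ht : t * (4 * D ^ 2) ≤ Fintype.card σ) (bad : Finset (Finset σ))
    (hbad : ∀ Y ∈ bad, ∀ l, NearlyBalanced D Y (univ.filter fun x => key x < l)) :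
    2 ^ t * bad.card ≤ 2 ^ Fintype.card σ := by
  -- Capping at the number of variables defines a prefix for every `k`, so that the family is
  -- monotone on all of `ℕ`; the cap is inactive for `k ≤ t`.
  have hex : ∀ k : ℕ, ∃ l, (univ.filter fun x => key x < l).card =
      min (k * (2 * (2 * D ^ 2))) (Fintype.card σ) :=
    fun k => exists_card_sublevel_eq hkey (min_le_right _ _)
  choose l hl using hex
  have hmono : Monotone fun k => univ.filter fun x => key x < l k := by
    intro k k' hkk
    rcases le_total (l k) (l k') with h | h
    · exact Finset.monotone_filter_right _ fun x _ hx => lt_of_lt_of_le hx h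
    · refine (Finset.eq_of_subset_of_card_le
        (Finset.monotone_filter_right _ fun x _ hx => lt_of_lt_of_le hx h) ?_).symm.subset
      rw [hl, hl]
      gcongr
  refine le_trans (Nat.mul_le_mul_left _ (Finset.card_le_card fun Y hY => ?_))
    (two_pow_mul_card_nearlyBalanced_le _ hmono D t fun k hk => ?_)
  · exact Finset.mem_filter.2 ⟨Finset.mem_univ _, fun k _ => hbad Y hY (l k)⟩
  · rw [hl, min_eq_left]
    calc k * (2 * (2 * D ^ 2)) ≤ t * (2 * (2 * D ^ 2)) := Nat.mul_le_mul_right _ hk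
      _ = t * (4 * D ^ 2) := by ring
      _ ≤ _ := ht

/-! ### Cutting an ROABP along its variable order -/

/-- Cutting a sum over paths at a layer: it becomes a sum over the nodes of this layer of products
of an expression in the labels before and an expression in the labels after the cut. -/
theorem exists_pathSum_eq {R A : Type*} [CommSemiring R] [CommSemiring A] [Algebra R A] (n : ℕ)
    (α : Fin (n + 1) → Type) [∀ i, Fintype (α i)]
    (e : (i : Fin n) → α i.castSucc → α i.succ → A) (a : α 0 → A) (b : α (Fin.last n) → A)
    (l : Fin (n + 1)) (T₁ T₂ : Subalgebra R A) (ha : ∀ u, a u ∈ T₁) (hb : ∀ u, b u ∈ T₂)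
    (h₁ : ∀ i : Fin n, (i : ℕ) < l → ∀ u v, e i u v ∈ T₁)
    (h₂ : ∀ i : Fin n, (l : ℕ) ≤ i → ∀ u v, e i u v ∈ T₂) :
    ∃ (f g : α l → A), (∀ u, f u ∈ T₁) ∧ (∀ u, g u ∈ T₂) ∧
      ∑ γ : (i : Fin (n + 1)) → α i, a (γ 0) * (∏ i : Fin n, e i (γ i.castSucc) (γ i.succ)) *
        b (γ (Fin.last n)) = ∑ u, f u * g u := by
  classical
  induction n with
  | zero =>
    obtain rfl : l = 0 := Fin.ext (by omega)
    refine ⟨a, b, ha, hb, ?_⟩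
    refine Fintype.sum_equiv (Equiv.piUnique (fun i : Fin 1 => α i)) _ _ fun γ => ?_
    rw [Fin.prod_univ_zero, mul_one]
    rfl
  | succ n ih =>
    have hsum : ∀ F : ((i : Fin (n + 2)) → α i) → A, ∑ γ, F γ =
        ∑ u : α 0, ∑ γ : (i : Fin (n + 1)) → α i.succ, F (Fin.cons u γ) := by
      intro F
      rw [← Fintype.sum_prod_type']
      exact (Fintype.sum_equiv (Fin.consEquiv α) _ _ fun _ => rfl).symm
    rw [hsum]
    cases l using Fin.cases with
    | zero =>
      refine ⟨a, fun u => ∑ γ : (i : Fin (n + 1)) → α i.succ,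
        (∏ i : Fin (n + 1), e i ((Fin.cons u γ : (i : Fin (n + 2)) → α i) i.castSucc) (γ i)) *
          b (γ (Fin.last n)), ha, fun u => ?_, ?_⟩
      · exact sum_mem fun γ _ => mul_mem (prod_mem fun i _ => h₂ i (by simp) _ _) (hb _)
      · refine Finset.sum_congr rfl fun u _ => ?_
        rw [Finset.mul_sum]
        refine Finset.sum_congr rfl fun γ _ => ?_
        rw [mul_assoc]
        rfl
    | succ l =>
      -- The edges of the first layer are absorbed into the start weight, which shortens the path by
      -- one.
      obtain ⟨f, g, hf, hg, hfg⟩ := ih (fun i => α i.succ) (fun i => e i.succ)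
        (fun v => ∑ u, a u * e 0 u v) b l
        (fun v => sum_mem fun u _ => mul_mem (ha u) (h₁ 0 (by simp) u v)) hb
        (fun i hi => h₁ i.succ (by simpa using hi)) (fun i hi => h₂ i.succ (by simpa using hi))
      refine ⟨f, g, hf, hg, ?_⟩
      rw [← hfg, Finset.sum_comm]
      refine Finset.sum_congr rfl fun γ _ => ?_
      rw [Finset.sum_mul, Finset.sum_mul]
      refine Finset.sum_congr rfl fun u _ => ?_
      rw [Fin.prod_univ_succ, ← mul_assoc]
      rfl

theorem ABP.exists_poly_eq {K σ : Type*} [CommSemiring K] (P : ABP K σ)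
    (l : Fin (P.depth + 1)) (V W : Set σ)
    (h₁ : ∀ i : Fin P.depth, (i : ℕ) < l → ∀ x, P.ReadsAt i x → x ∈ V)
    (h₂ : ∀ i : Fin P.depth, (l : ℕ) ≤ i → ∀ x, P.ReadsAt i x → x ∈ W) :
    ∃ f g : Fin (P.width l) → MvPolynomial σ K, (∀ u, f u ∈ supported K V) ∧
      (∀ u, g u ∈ supported K W) ∧ P.poly = ∑ u, f u * g u := by
  classical
  have hlabel : ∀ (U : Set σ) (i : Fin P.depth), (∀ x, P.ReadsAt i x → x ∈ U) →
      ∀ u v, labelPoly (P.edge i u v) ∈ supported K U := by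
    intro U i hU u v
    rcases h : P.edge i u v with _ | x | c
    · exact zero_mem _
    · exact Algebra.subset_adjoin ⟨x, hU x ⟨u, v, h⟩, rfl⟩
    · exact Subalgebra.algebraMap_mem _ _
  -- The endpoint conditions on paths become indicator weights.
  obtain ⟨f, g, hf, hg, hfg⟩ := exists_pathSum_eq (R := K) P.depth (fun i => Fin (P.width i))
    (fun i u v => labelPoly (P.edge i u v)) (fun u => if u = P.start then 1 else 0)
    (fun u => if u = P.terminal then 1 else 0) l (supported K V) (supported K W)
    (fun u => by split_ifs; exacts [one_mem _, zero_mem _])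
    (fun u => by split_ifs; exacts [one_mem _, zero_mem _])
    (fun i hi => hlabel V i (h₁ i hi)) (fun i hi => hlabel W i (h₂ i hi))
  refine ⟨f, g, hf, hg, ?_⟩
  rw [← hfg, ABP.poly, Finset.sum_filter]
  refine Finset.sum_congr rfl fun γ _ => ?_
  by_cases h1 : γ 0 = P.start <;> by_cases h2 : γ (Fin.last P.depth) = P.terminal <;>
    simp [h1, h2]

theorem ABP.width_le_size {K σ : Type*} (P : ABP K σ) (l : Fin (P.depth + 1)) :
    P.width l ≤ P.size :=
  Finset.single_le_sum (f := P.width) (fun _ _ => Nat.zero_le _) (Finset.mem_univ l)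

theorem ABP.size_pos {K σ : Type*} (P : ABP K σ) : 0 < P.size :=
  lt_of_lt_of_le P.start.pos (P.width_le_size 0)

/-- The variables of an ROABP are read in an order given by an injective function to `ℕ`, and the
polynomial can be cut at any place of this order. -/
theorem ABP.IsROABP.exists_key {K σ : Type*} [CommSemiring K] [Fintype σ] {P : ABP K σ}
    (hP : P.IsROABP) : ∃ key : σ → ℕ, Function.Injective key ∧ ∀ l : ℕ,
      ∃ (w : ℕ) (f g : Fin w → MvPolynomial σ K), w ≤ P.size ∧
        (∀ u, f u ∈ supported K {x | key x < l}) ∧ (∀ u, g u ∈ supported K {x | l ≤ key x}) ∧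
        P.poly = ∑ u, f u * g u := by
  classical
  -- Variables that are never read come after all layers, in an arbitrary order, which makes the key
  -- injective.
  set key : σ → ℕ := fun x => if h : ∃ i, P.ReadsAt i x then (h.choose : ℕ)
    else P.depth + Fintype.equivFin σ x with hkey
  have key_read : ∀ i x, P.ReadsAt i x → key x = i := by
    intro i x h
    have hex : ∃ i, P.ReadsAt i x := ⟨i, h⟩
    simp only [hkey, dif_pos hex]
    rw [hP.2 x _ _ hex.choose_spec h]
  have key_not : ∀ x, (¬ ∃ i, P.ReadsAt i x) → key x = P.depth + Fintype.equivFin σ x :=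
    fun x h => by simp only [hkey, dif_neg h]
  refine ⟨key, fun x y hxy => ?_, fun l => ?_⟩
  · by_cases hx : ∃ i, P.ReadsAt i x <;> by_cases hy : ∃ i, P.ReadsAt i y
    · obtain ⟨i, hi⟩ := hx
      obtain ⟨j, hj⟩ := hy
      rw [key_read i x hi, key_read j y hj] at hxy
      obtain rfl := Fin.ext hxy
      exact hP.1 i x y hi hj
    · obtain ⟨i, hi⟩ := hx
      rw [key_read i x hi, key_not y hy] at hxy
      omega
    · obtain ⟨j, hj⟩ := hy
      rw [key_not x hx, key_read j y hj] at hxy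
      omega
    · rw [key_not x hx, key_not y hy] at hxy
      exact (Fintype.equivFin σ).injective (Fin.ext (by omega))
  -- A cut beyond the last layer is made at the last layer, after which nothing is read.
  · have hlt : min l P.depth < P.depth + 1 := by omega
    obtain ⟨f, g, hf, hg, h⟩ := P.exists_poly_eq ⟨min l P.depth, hlt⟩ {x | key x < l}
      {x | l ≤ key x}
      (fun i hi x hx => by
        have := key_read i x hx
        simp only [Set.mem_ofPred_eq] at hi ⊢
        omega)
      (fun i hi x hx => by
        have := key_read i x hx
        simp only [Set.mem_ofPred_eq] at hi ⊢
        omega)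
    exact ⟨_, f, g, P.width_le_size _, hf, hg, h⟩

/-! ### Rank upper bound for sums of products -/

section Rank

variable {σ K : Type*} [DecidableEq σ] [Field K]

/-- The partial derivative matrix of a product of polynomials in disjoint sets `V`, `W` of variables
has rank at most `2 ^ (#(P ∩ V) + #(Q ∩ W))`: it vanishes on the kernel of so many functionals. -/
theorem sum_sqCoeff_mul_eq_zero {A B : MvPolynomial σ K} {V W P Q : Finset σ}
    (hA : A ∈ supported K (V : Set σ)) (hB : B ∈ supported K (W : Set σ)) (h : Disjoint V W)
    (hPQ : P ∪ Q ⊆ V ∪ W) (u : Finset σ → K)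
    (hu : ∀ P' ⊆ P ∩ V, ∀ Q' ⊆ Q ∩ W,
      ∑ T ∈ Q.powerset with T ∩ W = Q', sqCoeff A (P' ∪ (T ∩ V)) * u T = 0)
    {S : Finset σ} (hS : S ⊆ P) : ∑ T ∈ Q.powerset, sqCoeff (A * B) (S ∪ T) * u T = 0 := by
  rw [← Finset.sum_fiberwise_of_maps_to (t := (Q ∩ W).powerset) (g := fun T => T ∩ W)
    fun T hT => Finset.mem_powerset.2
      (Finset.inter_subset_inter_right (Finset.mem_powerset.1 hT))]
  refine Finset.sum_eq_zero fun Q' hQ' => ?_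
  have := hu (S ∩ V) (Finset.inter_subset_inter_right hS) Q' (Finset.mem_powerset.1 hQ')
  rw [← mul_zero (sqCoeff B ((S ∩ W) ∪ Q')), ← this, Finset.mul_sum]
  refine Finset.sum_congr rfl fun T hT => ?_
  rw [Finset.mem_filter, Finset.mem_powerset] at hT
  rw [sqCoeff_mul hA hB h ((Finset.union_subset_union hS hT.1).trans hPQ),
    Finset.union_inter_distrib_right, Finset.union_inter_distrib_right, hT.2]
  ring

/-- A sum of products, each of them of polynomials in disjoint sets of variables, does not have full
rank if the partial derivative matrices of the products are small enough. -/
theorem two_pow_card_le_of_fullRank_sum {ι : Type*} [Fintype ι] (A B : ι → MvPolynomial σ K)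
    (V W : ι → Finset σ) {P Q : Finset σ} (hA : ∀ i, A i ∈ supported K (V i : Set σ))
    (hB : ∀ i, B i ∈ supported K (W i : Set σ)) (h : ∀ i, Disjoint (V i) (W i))
    (hPQ : ∀ i, P ∪ Q ⊆ V i ∪ W i) (hf : FullRank (∑ i, A i * B i) P Q) :
    2 ^ Q.card ≤ ∑ i, 2 ^ ((P ∩ V i).card + (Q ∩ W i).card) := by
  by_contra hlt
  rw [not_le] at hlt
  let ext : (Q.powerset → K) → Finset σ → K :=
    fun v T => if h : T ∈ Q.powerset then v ⟨T, h⟩ else 0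
  -- One functional for each summand and each pair `(P', Q')`. With fewer functionals than columns,
  -- some nonzero vector is killed by all of them, hence by the matrix of every summand.
  let I := Σ i, ((P ∩ V i).powerset × (Q ∩ W i).powerset)
  let φ : (Q.powerset → K) →ₗ[K] (I → K) :=
    { toFun := fun v x => ∑ T ∈ Q.powerset with T ∩ W x.1 = x.2.2,
        sqCoeff (A x.1) (x.2.1 ∪ (T ∩ V x.1)) * ext v T
      map_add' := fun v v' => by
        funext x
        simp only [Pi.add_apply]
        rw [← Finset.sum_add_distrib]
        refine Finset.sum_congr rfl fun T hT => ?_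
        have hT' := (Finset.mem_filter.1 hT).1
        simp only [ext, dif_pos hT', Pi.add_apply]
        ring
      map_smul' := fun c v => by
        funext x
        simp only [Pi.smul_apply, smul_eq_mul, RingHom.id_apply]
        rw [Finset.mul_sum]
        refine Finset.sum_congr rfl fun T hT => ?_
        have hT' := (Finset.mem_filter.1 hT).1
        simp only [ext, dif_pos hT', Pi.smul_apply, smul_eq_mul]
        ring }
  have hfin : Module.finrank K (I → K) < Module.finrank K (Q.powerset → K) := by
    rw [Module.finrank_fintype_fun_eq_card, Module.finrank_fintype_fun_eq_card]
    simpa only [I, Fintype.card_sigma, Fintype.card_prod, Fintype.card_coe, Finset.card_powerset,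
      ← pow_add] using hlt
  obtain ⟨v, hv, hv0⟩ := Submodule.exists_mem_ne_zero_of_ne_bot
    (LinearMap.ker_ne_bot_of_finrank_lt (f := φ) hfin)
  apply hv0
  rw [LinearMap.mem_ker] at hv
  have := hf (ext v) fun S hS => ?_
  · funext T
    have hT := this T (Finset.mem_powerset.1 T.2)
    simp only [ext, dif_pos T.2] at hT
    exact hT
  · simp only [sqCoeff_sum, Finset.sum_mul]
    rw [Finset.sum_comm]
    refine Finset.sum_eq_zero fun i _ => ?_
    refine sum_sqCoeff_mul_eq_zero (hA i) (hB i) (h i) (hPQ i) (ext v)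
      (fun P' hP' Q' hQ' => ?_) hS
    exact congrFun hv ⟨i, ⟨P', Finset.mem_powerset.2 hP'⟩, ⟨Q', Finset.mem_powerset.2 hQ'⟩⟩

end Rank

/-! ### Full rank of the polynomial, and the lower bound -/

/-- The Raz–Yehudayoff polynomial has full rank with respect to every balanced partition of its
variables. -/
theorem fullRank_hardPoly (F : Type*) [Field F] (N : ℕ) (Y : Finset (Idx N))
    (hY : 2 * Y.card = N) : FullRank (hardPoly F N) Y Yᶜ := by
  let v : Idx N ↪ ℕ := Function.Embedding.subtype _
  have hsub : Y.map v ⊆ Icc 1 N := by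
    intro p hp
    obtain ⟨q, -, rfl⟩ := Finset.mem_map.1 hp
    exact q.2
  have e1 : Icc 1 N ∩ Y.map v = Y.map v := Finset.inter_eq_right.2 hsub
  have e2 : Icc 1 N \ Y.map v = Yᶜ.map v := by
    ext p
    simp only [v, Finset.mem_sdiff, Finset.mem_map, Finset.mem_compl,
      Function.Embedding.subtype_apply, Subtype.exists, exists_and_right, exists_eq_right]
    exact ⟨fun ⟨h1, h2⟩ => ⟨h1, fun h => h2 ⟨h1, h⟩⟩,
      fun ⟨h1, h2⟩ => ⟨h1, fun ⟨_, h⟩ => h2 h⟩⟩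
  have hcard : (Y.map v).card = (Yᶜ.map v).card := by
    have := Finset.card_add_card_compl Y
    rw [Fintype.card_coe, Nat.card_Icc] at this
    rw [Finset.card_map, Finset.card_map]
    omega
  -- `F` may be finite; its algebraic closure has enough elements for the generic choices of
  -- parameters.
  obtain ⟨w, hw⟩ := exists_fullRank_gRec (K := AlgebraicClosure F) (Y.map v) 1 N
    (by rw [excess_eq, e1, e2, hcard, sub_self])
  rw [e1, e2] at hw
  let R := MvPolynomial (Idx N × Idx N × Idx N) F
  let wR : ℕ → ℕ → ℕ → R := fun i k j =>
    if h : i ∈ Finset.Icc 1 N ∧ k ∈ Finset.Icc 1 N ∧ j ∈ Finset.Icc 1 N then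
      X (⟨i, h.1⟩, ⟨k, h.2.1⟩, ⟨j, h.2.2⟩) else 0
  let φ : R →+* AlgebraicClosure F := (aeval fun x : Idx N × Idx N × Idx N =>
    w x.1 x.2.1 x.2.2 : R →ₐ[F] AlgebraicClosure F).toRingHom
  have hφ : map φ (gRec X (fun a b c => C (wR a b c)) 1 N) =
      gRec X (fun a b c => C (w a b c)) 1 N := by
    rw [map_gRec]
    refine gRec_congr (fun p _ _ => map_X _ _) fun a b c h1 h2 h3 h4 => ?_
    have h : a ∈ Finset.Icc 1 N ∧ b ∈ Finset.Icc 1 N ∧ c ∈ Finset.Icc 1 N := by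
      simp only [Finset.mem_Icc]; omega
    rw [map_C]
    congr 1
    simp only [wR, dif_pos h, φ]
    exact aeval_X _ _
  have hψ : map (algebraMap R (RatField F N)) (gRec X (fun a b c => C (wR a b c)) 1 N) =
      rename v (hardPoly F N) := by
    have := map_gRec (rename v : MvPolynomial (Idx N) (RatField F N) →ₐ[_] _).toRingHom
      (xVar F N) (wVar F N) 1 N
    rw [hardPoly]
    refine Eq.trans ?_ this.symm
    rw [map_gRec]
    refine gRec_congr (fun p h1 h2 => ?_) fun a b c h1 h2 h3 h4 => ?_
    · have hp : p ∈ Finset.Icc 1 N := Finset.mem_Icc.2 ⟨h1, h2⟩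
      rw [map_X, xVar, dif_pos hp]
      exact (rename_X (R := RatField F N) v ⟨p, hp⟩).symm
    · have h : a ∈ Finset.Icc 1 N ∧ b ∈ Finset.Icc 1 N ∧ c ∈ Finset.Icc 1 N := by
        simp only [Finset.mem_Icc]; omega
      rw [map_C, wVar, dif_pos h]
      simp only [wR, dif_pos h]
      exact (rename_C (R := RatField F N) v _).symm
  have hfull := fullRank_map_of_fullRank_map φ (algebraMap R (RatField F N))
    (IsFractionRing.injective R (RatField F N)) _ hcard (by rw [hφ]; exact hw)
  rw [hψ] at hfull
  exact fullRank_of_rename v hfull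

/-- If a balanced set `Y` of variables is unbalanced somewhere in the order of each ROABP, then the
sum of the ROABPs does not have full rank with respect to `Y`, unless there are many of them. -/
theorem two_pow_le_of_fullRank_of_not_nearlyBalanced {σ K : Type*} [Fintype σ] [DecidableEq σ]
    [Field K] {m s D : ℕ} (p : Fin m → MvPolynomial σ K) (key : Fin m → σ → ℕ)
    (hp : ∀ i, ∀ l : ℕ, ∃ (w : ℕ) (f g : Fin w → MvPolynomial σ K), w ≤ s ∧
        (∀ u, f u ∈ supported K {x | key i x < l}) ∧
        (∀ u, g u ∈ supported K {x | l ≤ key i x}) ∧ p i = ∑ u, f u * g u)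
    {Y : Finset σ} (hY : 2 * Y.card = Fintype.card σ) (hf : FullRank (∑ i, p i) Y Yᶜ)
    (hun : ∀ i, ∃ l, ¬ NearlyBalanced D Y (univ.filter fun x => key i x < l)) :
    2 ^ D ≤ m * s := by
  have hcut : ∀ i, ∃ (w : ℕ) (A B : Fin w → MvPolynomial σ K) (V W : Finset σ), w ≤ s ∧
      (∀ u, A u ∈ supported K (V : Set σ)) ∧ (∀ u, B u ∈ supported K (W : Set σ)) ∧
      Disjoint V W ∧ Y ∪ Yᶜ ⊆ V ∪ W ∧ p i = ∑ u, A u * B u ∧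
      (Y ∩ V).card + (Yᶜ ∩ W).card + D ≤ Y.card := by
    intro i
    obtain ⟨l, hl⟩ := hun i
    obtain ⟨w, f, g, hw, hf, hg, h⟩ := hp i l
    set V := univ.filter fun x => key i x < l with hV
    have eV : {x | key i x < l} = (V : Set σ) := by ext x; simp [hV]
    have eW : {x | l ≤ key i x} = ((Vᶜ : Finset σ) : Set σ) := by ext x; simp [hV]
    rw [eV] at hf
    rw [eW] at hg
    unfold NearlyBalanced at hl
    have c1 := Finset.card_inter_add_card_sdiff Y V
    have c2 := Finset.card_inter_add_card_sdiff V Y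
    have c3 := Finset.card_inter_add_card_sdiff Yᶜ V
    have c4 := Finset.card_add_card_compl Y
    rw [Finset.inter_comm V Y] at c2
    have c5 : V \ Y = Yᶜ ∩ V := by ext x; simp [and_comm]
    have c6 : Y \ V = Y ∩ Vᶜ := by ext x; simp
    have c7 : Yᶜ \ V = Yᶜ ∩ Vᶜ := by ext x; simp
    rw [c5] at c2
    rw [c6] at c1
    rw [c7] at c3
    rw [not_lt, le_abs] at hl
    -- The first factor must be the side of the cut where `Y` is in the minority. If `Y` dominates
    -- the prefix, it is in the minority on the suffix because `Y` is balanced, so the roles are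
    -- exchanged.
    rcases hl with hl | hl
    · refine ⟨w, g, f, Vᶜ, V, hw, hg, hf, disjoint_compl_left, ?_, ?_, by omega⟩
      · rw [Finset.union_comm Vᶜ, Finset.union_compl, Finset.union_compl]
      · rw [h]
        exact Finset.sum_congr rfl fun u _ => mul_comm _ _
    · refine ⟨w, f, g, V, Vᶜ, hw, hf, hg, disjoint_compl_right, ?_, h, by omega⟩
      rw [Finset.union_compl, Finset.union_compl]
  choose w A B V W hw hA hB hd hVW h hcard using hcut
  have hsum : ∑ i, p i = ∑ x : (Σ i, Fin (w i)), A x.1 x.2 * B x.1 x.2 := by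
    rw [Fintype.sum_sigma]
    exact Finset.sum_congr rfl fun i _ => h i
  rw [hsum] at hf
  have key := two_pow_card_le_of_fullRank_sum _ _ (fun x : (Σ i, Fin (w i)) => V x.1)
    (fun x => W x.1) (fun x => hA x.1 x.2) (fun x => hB x.1 x.2) (fun x => hd x.1)
    (fun x => hVW x.1) hf
  have hYc : Yᶜ.card = Y.card := by
    have := Finset.card_add_card_compl Y
    omega
  rw [hYc] at key
  have h2 : 2 ^ Y.card * 2 ^ D ≤ 2 ^ Y.card * (m * s) := by
    calc 2 ^ Y.card * 2 ^ D ≤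
        (∑ x : (Σ i, Fin (w i)), 2 ^ ((Y ∩ V x.1).card + (Yᶜ ∩ W x.1).card)) * 2 ^ D :=
          Nat.mul_le_mul_right _ key
      _ ≤ ∑ _x : (Σ i, Fin (w i)), 2 ^ Y.card := by
          rw [Finset.sum_mul]
          refine Finset.sum_le_sum fun x _ => ?_
          rw [← pow_add]
          exact Nat.pow_le_pow_right (by norm_num) (hcard x.1)
      _ = (∑ i, w i) * 2 ^ Y.card := by
          rw [Finset.sum_const, Finset.card_univ, Fintype.card_sigma, smul_eq_mul]
          simp
      _ ≤ (∑ _i : Fin m, s) * 2 ^ Y.card :=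
          Nat.mul_le_mul_right _ (Finset.sum_le_sum fun i _ => hw i)
      _ = 2 ^ Y.card * (m * s) := by simp [mul_comm]
  exact Nat.le_of_mul_le_mul_left h2 (by positivity)

/-- If the first alternative fails, every balanced set is nearly balanced on all prefixes of one of
the `m` orders, and the union bound over the orders gives the second. -/
theorem two_pow_le_mul_or_of_hardPoly_eq_sum {F : Type*} [Field F] {N m s : ℕ} (D t : ℕ)
    (hN : Even N) (hN0 : 0 < N) (ht : t * (4 * D ^ 2) ≤ N)
    (P : Fin m → ABP (RatField F N) (Idx N)) (hP : ∀ i, (P i).IsROABP)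
    (hs : ∀ i, (P i).size ≤ s) (hsum : hardPoly F N = ∑ i, (P i).poly) :
    2 ^ D ≤ m * s ∨ 2 ^ t ≤ m * N := by
  obtain ⟨n, hn⟩ := hN
  have hσ : Fintype.card (Idx N) = N := by simp
  refine or_iff_not_imp_left.2 fun hlt => ?_
  choose key hkey hcut using fun i => (hP i).exists_key
  have hcov : ∀ Y ∈ (univ : Finset (Idx N)).powersetCard n, ∃ i, ∀ l,
      NearlyBalanced D Y (univ.filter fun x => key i x < l) := by
    intro Y hY
    by_contra hcon
    push Not at hcon
    have hYn : 2 * Y.card = N := by rw [(Finset.mem_powersetCard.1 hY).2]; omega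
    refine hlt (two_pow_le_of_fullRank_of_not_nearlyBalanced (fun i => (P i).poly) key
      (fun i l => ?_) (by rw [hσ, hYn]) (hsum ▸ fullRank_hardPoly F N Y hYn) hcon)
    obtain ⟨w, f, g, h1, h2⟩ := hcut i l
    exact ⟨w, f, g, h1.trans (hs i), h2⟩
  classical
  let bad : Fin m → Finset (Finset (Idx N)) := fun i =>
    univ.filter fun Y => ∀ l, NearlyBalanced D Y (univ.filter fun x => key i x < l)
  have hbad : ∀ i, 2 ^ t * (bad i).card ≤ 2 ^ N := fun i => by
    have := two_pow_mul_card_nearlyBalanced_sublevel_le (hkey i) D t (by rwa [hσ]) (bad i)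
      fun Y hY => (Finset.mem_filter.1 hY).2
    rwa [hσ] at this
  have h1 : n.centralBinom ≤ ∑ i, (bad i).card := by
    calc n.centralBinom = ((univ : Finset (Idx N)).powersetCard n).card := by
          rw [Finset.card_powersetCard, Finset.card_univ, hσ, Nat.centralBinom, hn, two_mul]
      _ ≤ (univ.biUnion bad).card := by
          refine Finset.card_le_card fun Y hY => ?_
          obtain ⟨i, hi⟩ := hcov Y hY
          exact Finset.mem_biUnion.2
            ⟨i, Finset.mem_univ _, Finset.mem_filter.2 ⟨Finset.mem_univ _, hi⟩⟩
      _ ≤ _ := Finset.card_biUnion_le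
  -- Passing from all sets to balanced ones costs only a factor `N`.
  have h2 : 2 ^ N ≤ N * n.centralBinom := by
    have := Nat.four_pow_le_two_mul_self_mul_centralBinom n (by omega)
    rw [show (4 : ℕ) = 2 ^ 2 by norm_num, ← pow_mul, show 2 * n = N by omega] at this
    exact this
  have h3 : 2 ^ t * n.centralBinom ≤ m * N * n.centralBinom := by
    calc 2 ^ t * n.centralBinom ≤ ∑ i, 2 ^ t * (bad i).card := by
          rw [← Finset.mul_sum]
          exact Nat.mul_le_mul_left _ h1
      _ ≤ ∑ _i : Fin m, 2 ^ N := Finset.sum_le_sum fun i _ => hbad i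
      _ = m * 2 ^ N := by simp
      _ ≤ m * (N * n.centralBinom) := Nat.mul_le_mul_left _ h2
      _ = _ := by ring
  exact Nat.le_of_mul_le_mul_right h3 (Nat.centralBinom_pos n)

/-- The choice is `D = q + 1` and `t = 7 * q`: since `N ≤ 2 ^ (5 * q)`, the factor `N` uses up `5 *
q` of the exponent and `2 * q` remains. The blocks occupy about `28 * q ^ 3` variables, which `q ^
5` accommodates once `q ≥ 12`. -/
theorem two_pow_le_mul_of_hardPoly_eq_sum {F : Type*} [Field F] {N m s q : ℕ} (hN : Even N)
    (hq : 12 ≤ q) (hqN : q ^ 5 ≤ N) (hNq : N < (q + 1) ^ 5)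
    (P : Fin m → ABP (RatField F N) (Idx N)) (hP : ∀ i, (P i).IsROABP)
    (hs : ∀ i, (P i).size ≤ s) (hsum : hardPoly F N = ∑ i, (P i).poly) :
    2 ^ (q + 1) ≤ m * s := by
  have ht : 7 * q * (4 * (q + 1) ^ 2) ≤ N := by
    refine le_trans ?_ hqN
    have h1 : 28 * (q + 1) ^ 2 ≤ 12 ^ 2 * q ^ 2 := by nlinarith
    calc 7 * q * (4 * (q + 1) ^ 2) = q * (28 * (q + 1) ^ 2) := by ring
      _ ≤ q * (12 ^ 2 * q ^ 2) := Nat.mul_le_mul_left _ h1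
      _ ≤ q * (q ^ 2 * q ^ 2) := by gcongr
      _ = q ^ 5 := by ring
  have hN0 : 0 < N := lt_of_lt_of_le (by positivity) hqN
  rcases two_pow_le_mul_or_of_hardPoly_eq_sum (q + 1) (7 * q) hN hN0 ht P hP hs hsum with h | h
  · exact h
  · have hN2 : N ≤ 2 ^ (5 * q) := by
      refine hNq.le.trans ?_
      rw [mul_comm, pow_mul]
      exact Nat.pow_le_pow_left (Nat.lt_two_pow_self (n := q)) 5
    have hm : 2 ^ (2 * q) ≤ m := by
      refine Nat.le_of_mul_le_mul_right (c := 2 ^ (5 * q)) ?_ (by positivity)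
      rw [← pow_add, show 2 * q + 5 * q = 7 * q by ring]
      exact h.trans (Nat.mul_le_mul_left _ hN2)
    have hm0 : 0 < m := lt_of_lt_of_le (by positivity) hm
    have hs0 : 0 < s := lt_of_lt_of_le (P ⟨0, hm0⟩).size_pos (hs _)
    calc 2 ^ (q + 1) ≤ 2 ^ (2 * q) := Nat.pow_le_pow_right (by norm_num) (by omega)
      _ ≤ m := hm
      _ ≤ m * s := Nat.le_mul_of_pos_right _ hs0

end ROABP

theorem theorem1 :
    ∃ ε c : ℝ, 0 < ε ∧ 0 < c ∧ ∃ N₀ : ℕ,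
      ∀ (F : Type*) [Field F] (N : ℕ), N₀ ≤ N → Even N →
        ∀ (m s : ℕ) (P : Fin m → ROABP.ABP (ROABP.RatField F N) (ROABP.Idx N)),
          (∀ i, (P i).IsROABP) → (∀ i, (P i).size ≤ s) →
          ROABP.hardPoly F N = ∑ i, (P i).poly →
          (2 : ℝ) ^ (ε * (N : ℝ) ^ ((1 : ℝ) / 5)) / (s : ℝ) ^ (c * Real.logb 2 (N : ℝ)) ≤ (m : ℝ) := by
  -- `12 ^ 5` ensures that the integer fifth root `q` of `N` is at least 12. The bound `2 ^ (q + 1)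
  -- ≤ m * s` is then weakened by `s ≤ s ^ logb 2 N`, which needs `s ≥ 1` and `N ≥ 2`.
  refine ⟨1, 1, one_pos, one_pos, 12 ^ 5, fun F _ N hN₀ hN m s P hP hs hsum => ?_⟩
  have hqN : Nat.nthRoot 5 N ^ 5 ≤ N := Nat.pow_nthRoot_le (Or.inl (by norm_num))
  have hNq : N < (Nat.nthRoot 5 N + 1) ^ 5 := Nat.lt_pow_nthRoot_add_one (by norm_num) N
  set q := Nat.nthRoot 5 N
  have hq : 12 ≤ q := by
    have := (Nat.pow_lt_pow_iff_left (n := 5) (by norm_num)).1 (lt_of_le_of_lt hN₀ hNq)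
    omega
  have h := ROABP.two_pow_le_mul_of_hardPoly_eq_sum hN hq hqN hNq P hP hs hsum
  have hs1 : 1 ≤ s := by
    rcases Nat.eq_zero_or_pos s with rfl | hs
    · simp at h
    · exact hs
  have hs1' : (1 : ℝ) ≤ s := by exact_mod_cast hs1
  have hroot : (N : ℝ) ^ ((1 : ℝ) / 5) ≤ (q + 1 : ℕ) := by
    have h5 : ((q + 1 : ℕ) : ℝ) = (((q + 1 : ℕ) : ℝ) ^ (5 : ℕ)) ^ ((1 : ℝ) / 5) := by
      rw [← Real.rpow_natCast, ← Real.rpow_mul (by positivity)]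
      norm_num
    rw [h5]
    refine Real.rpow_le_rpow (by positivity) ?_ (by norm_num)
    exact_mod_cast hNq.le
  have hlog : 1 ≤ Real.logb 2 (N : ℝ) := by
    rw [Real.le_logb_iff_rpow_le (by norm_num) (by exact_mod_cast lt_of_lt_of_le (by norm_num) hN₀),
      Real.rpow_one]
    exact_mod_cast le_trans (by norm_num) hN₀
  rw [one_mul, one_mul, div_le_iff₀ (Real.rpow_pos_of_pos (by linarith) _)]
  calc (2 : ℝ) ^ ((N : ℝ) ^ ((1 : ℝ) / 5)) ≤ (2 : ℝ) ^ (((q + 1 : ℕ) : ℝ)) :=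
        Real.rpow_le_rpow_of_exponent_le (by norm_num) hroot
    _ = ((2 ^ (q + 1) : ℕ) : ℝ) := by rw [Real.rpow_natCast]; push_cast; rfl
    _ ≤ ((m * s : ℕ) : ℝ) := by exact_mod_cast h
    _ = (m : ℝ) * (s : ℝ) ^ (1 : ℝ) := by rw [Real.rpow_one]; push_cast; rfl
    _ ≤ (m : ℝ) * (s : ℝ) ^ Real.logb 2 (N : ℝ) :=
        mul_le_mul_of_nonneg_left (Real.rpow_le_rpow_of_exponent_le hs1' hlog) (by positivity)
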